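/- Let $K$ be a subfield of $\mathbb{R}$, regarded as an ordered field with the order and the topology induced from $\mathbb{R}$. Let $D\subseteq K$ be a discrete set (that is, its subspace topology is discrete; $D$ need not be closed), let $n\in\mathbb{N}$, and let $f:D^n\to K$ be a function whose image $f(D^n)$ is somewhere dense in $K$, i.e. the closure of $f(D^n)$ in $K$ has nonempty interior in $K$. Let $(K,f)$ be the first-order structure $(K,0,1,-,+,\cdot,<,\Gamma_f)$, where $\Gamma_f\subseteq K^{n+1}$ is the graph of $f$. Then $\mathbb{Z}$ is definable with parameters from $K$ in $(K,f)$. -/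

import Mathlib

/-- Relation symbols of the language of ordered rings with one extra relation symbol of
arity `n + 1`, standing for the graph of a (partial) function of `n` variables. -/
inductive OrderedRingGraphRel (n : ℕ) : ℕ → Type
  | lt : OrderedRingGraphRel n 2
  | graph : OrderedRingGraphRel n (n + 1)

/-- The language of ordered rings (`0, 1, -, +, *, <`) with a symbol for the graph of a
(partial) function of `n` variables. -/
def orderedRingGraph (n : ℕ) : FirstOrder.Language.{0, 0} where
  Functions := FirstOrder.ringFunc
  Relations := OrderedRingGraphRel n

/-- The expansion `(K, f)` of the ordered field `K`, a subfield of `ℝ`, by a function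
`f : Dⁿ → K` with `D ⊆ K`: the new symbol is interpreted as the graph of `f`, as a subset
of `Kⁿ⁺¹`. -/
@[reducible]
noncomputable def fieldExpansion (K : Subfield ℝ) (D : Set K) (n : ℕ) (f : (Fin n → D) → K) :
    (orderedRingGraph n).Structure K where
  funMap
    | .zero, _ => 0
    | .one, _ => 1
    | .neg, x => - x 0
    | .add, x => x 0 + x 1
    | .mul, x => x 0 * x 1
  RelMap
    | .lt, x => x 0 < x 1
    | .graph, x => ∃ d : Fin n → D, (∀ i : Fin n, x i.castSucc = d i) ∧ x (Fin.last n) = f d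

/-- A set is somewhere dense if its closure has nonempty interior. -/
def SomewhereDense {X : Type*} [TopologicalSpace X] (S : Set X) : Prop :=
  (interior (closure S)).Nonempty

/-! Discreteness of `D` makes the range `E` of `f` an increasing union of uniformly definable finite
sets: a point of `D` gets level `t` once `t` bounds its absolute value and the reciprocal of its
distance to the rest of `D`. Ordering values by first level, then by size, gives a definable order
`R` on `E` with finite initial segments (`hasFiniteInitialSegments_levelLT`), while `E` remains
dense in some interval.

Such a pair lets single elements `c` code finite sequences. Each `d` in `E` with a predecessor has a
positive gap to its predecessors; `c` is marked by the `d` for which it lies just to the right of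
`d` on the scale of `κ` times that gap, and the relative position is the coded entry. A number `m ≥
0` is accepted if, to every precision, some `c` codes a walk from about `s` to about `s * (m + 1)`
in steps of about `s`, where `s = 1 / (m + 2)` keeps all entries below `1`.

An accepted `m` is natural because a walk strictly increasing in `R` and bounded by `b` is finite,
and its errors can be made small (`IsCodedNat.exists_eq_natCast`). Conversely, density provides
nested marking intervals that realize the walk; `exists_unmarked` prevents unwanted marks in
between. The integers are then the accepted numbers and their negatives. -/

/-! ### Coding finite sequences in an ordered field by a somewhere dense set with finite initial
segments -/

section Coding

variable {K : Type*} [Field K] [LinearOrder K] [IsStrictOrderedRing K]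

/-- `R` restricts to a strict linear order on `E` all of whose proper initial segments are
finite. -/
structure HasFiniteInitialSegments {K : Type*} (E : Set K) (R : K → K → Prop) : Prop where
  irrefl : ∀ x, ¬ R x x
  trans : ∀ x ∈ E, ∀ y ∈ E, ∀ z ∈ E, R x y → R y z → R x z
  total : ∀ x ∈ E, ∀ y ∈ E, R x y ∨ x = y ∨ R y x
  finite : ∀ y ∈ E, {x | x ∈ E ∧ R x y}.Finite

/-- `g` is the distance from `d` to the set of elements of `E` that precede `d`. -/
def IsGap (E : Set K) (R : K → K → Prop) (d g : K) : Prop :=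
  0 < g ∧ (∃ x, x ∈ E ∧ R x d ∧ (x = d + g ∨ x = d - g)) ∧
    ∀ x, x ∈ E ∧ R x d → d + g ≤ x ∨ x ≤ d - g

/-- `c` lies to the right of `d ∈ E`, closer than `κ` times the gap `g` of `d`, and `v` is the
ratio of the distance `c - d` to `κ * g`. -/
def Marks (E : Set K) (R : K → K → Prop) (κ c d v : K) : Prop :=
  d ∈ E ∧ 0 < v ∧ v < 1 ∧ ∃ g, IsGap E R d g ∧ c = d + v * (κ * g)

/-- The ratios of the marks of `c` between `a` and `b` advance by steps of length `s`, up to an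
error `δ`. -/
def CodesSteps (E : Set K) (R : K → K → Prop) (s δ κ c a b : K) : Prop :=
  ∀ d, ∀ v, Marks E R κ c d v ∧ (R a d ∨ a = d) ∧ R d b →
    ∃ d', ∃ v', Marks E R κ c d' v' ∧ R d d' ∧ (R d' b ∨ d' = b) ∧
      v + s - δ < v' ∧ v' < v + s + δ

/-- The first-order condition on `m` that turns out to define the set of natural numbers. -/
def IsCodedNat (E : Set K) (R : K → K → Prop) (m : K) : Prop :=
  ¬ m < 0 ∧ ∃ s, s * (m + (1 + 1)) = 1 ∧ ∀ δ, 0 < δ → ∃ κ, ∃ c, ∃ a, ∃ b, ∃ v, ∃ w,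
    0 < κ ∧ Marks E R κ c a v ∧ Marks E R κ c b w ∧ (R a b ∨ a = b) ∧
      (s - δ < v ∧ v < s + δ) ∧ (s * (m + 1) - δ < w ∧ w < s * (m + 1) + δ) ∧
        CodesSteps E R s δ κ c a b

variable {E : Set K} {R : K → K → Prop}

theorem IsGap.unique {d g g' : K} (h : IsGap E R d g) (h' : IsGap E R d g') : g = g' := by
  obtain ⟨h0, ⟨x, hx, hxd, hxg⟩, hm⟩ := h
  obtain ⟨h0', ⟨y, hy, hyd, hyg⟩, hm'⟩ := h'
  have h1 := hm y ⟨hy, hyd⟩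
  have h2 := hm' x ⟨hx, hxd⟩
  apply le_antisymm
  · rcases hyg with rfl | rfl <;> rcases h1 with h1 | h1 <;> linarith
  · rcases hxg with rfl | rfl <;> rcases h2 with h2 | h2 <;> linarith

theorem Marks.unique {κ c d v v' : K} (hκ : 0 < κ) (h : Marks E R κ c d v)
    (h' : Marks E R κ c d v') : v = v' := by
  obtain ⟨-, -, -, g, hg, hc⟩ := h
  obtain ⟨-, -, -, g', hg', hc'⟩ := h'
  obtain rfl := hg.unique hg'
  have : v * (κ * g) = v' * (κ * g) := by linarith
  exact mul_right_cancel₀ (mul_pos hκ hg.1).ne' this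

theorem exists_isGap (hR : HasFiniteInitialSegments E R) {d x : K} (hd : d ∈ E) (hx : x ∈ E)
    (hxd : R x d) : ∃ g, IsGap E R d g := by
  obtain ⟨y, ⟨hy, hyd⟩, hmin⟩ := Set.exists_min_image _ (fun y => |y - d|) (hR.finite d hd)
    ⟨x, hx, hxd⟩
  have hne : y ≠ d := fun h => hR.irrefl d (h ▸ hyd)
  refine ⟨|y - d|, abs_pos.2 (sub_ne_zero.2 hne), ⟨y, hy, hyd, ?_⟩, fun z hz => ?_⟩
  · rcases abs_choice (y - d) with h | h <;> rw [h]
    · left; ring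
    · right; ring
  · have := hmin z hz
    rcases le_abs.1 this with h | h
    · left; linarith
    · right; linarith

/-! ### Coded numbers are natural numbers -/

/-- Every step moves forward in `R`, and only finitely many elements of `E` remain up to `b`, so the
walk must end at `b`. The induction is on a bound `k` for that number; `N` counts the steps made,
and each adds at most `δ` to the error. -/
theorem CodesSteps.exists_nat (hR : HasFiniteInitialSegments E R) {s δ κ c a b : K}
    (hs : CodesSteps E R s δ κ c a b) (hb : b ∈ E) (ha : a ∈ E) (k : ℕ) :
    ∀ (d v : K) (N : ℕ), {x | x ∈ E ∧ R d x ∧ (R x b ∨ x = b)}.ncard ≤ k →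
      Marks E R κ c d v → (R a d ∨ a = d) → (R d b ∨ d = b) → |v - (N + 1) * s| ≤ (N + 1) * δ →
        ∃ (w : K) (M : ℕ), Marks E R κ c b w ∧ |w - (M + 1) * s| ≤ (M + 1) * δ := by
  have hfin : ∀ d, {x | x ∈ E ∧ R d x ∧ (R x b ∨ x = b)}.Finite := fun d =>
    ((hR.finite b hb).insert b).subset fun x hx => by
      rcases hx with ⟨h1, -, h2 | h2⟩
      · exact Or.inr ⟨h1, h2⟩
      · exact Or.inl h2
  induction k with
  | zero =>
    intro d v N hk hm had hdb hv
    rcases hdb with hdb | rfl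
    · rw [Nat.le_zero, Set.ncard_eq_zero (hfin d)] at hk
      exact absurd ⟨hb, hdb, Or.inr rfl⟩ (Set.eq_empty_iff_forall_notMem.1 hk b)
    · exact ⟨v, N, hm, hv⟩
  | succ k ih =>
    intro d v N hk hm had hdb hv
    rcases hdb with hdb | rfl
    · obtain ⟨d', v', hm', hdd', hd'b, h1, h2⟩ := hs d v ⟨hm, had, hdb⟩
      refine ih d' v' (N + 1) ?_ hm' (Or.inl ?_) hd'b ?_
      · refine Nat.lt_succ_iff.1 (lt_of_lt_of_le (Set.ncard_lt_ncard ?_ (hfin d)) hk)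
        refine ⟨fun x hx => ⟨hx.1, hR.trans d hm.1 d' hm'.1 x hx.1 hdd' hx.2.1, hx.2.2⟩, ?_⟩
        intro h
        exact hR.irrefl d' (h (show d' ∈ _ from ⟨hm'.1, hdd', hd'b⟩)).2.1
      · rcases had with h | rfl
        · exact hR.trans a ha d hm.1 d' hm'.1 h hdd'
        · exact hdd'
      · push_cast
        rw [abs_le] at hv ⊢
        constructor <;> linarith
    · exact ⟨v, N, hm, hv⟩

/-- Distinct natural numbers are at least `1` apart, so the one within `1 / 2` of `m` is the only
candidate at every smaller precision. No Archimedean property is needed. -/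
theorem exists_eq_natCast_of_approx {m : K} (h : ∀ η > 0, ∃ N : ℕ, |m - N| < η) :
    ∃ N : ℕ, m = N := by
  obtain ⟨N, hN⟩ := h (1 / 2) (by norm_num)
  refine ⟨N, ?_⟩
  by_contra hne
  have hpos : 0 < |m - N| := abs_pos.2 (sub_ne_zero.2 hne)
  obtain ⟨M, hM⟩ := h |m - N| hpos
  have h1 : |(N : K) - M| < 1 := by
    have := abs_sub_le (N : K) m M
    rw [abs_sub_comm (N : K) m] at this
    linarith
  have h2 : N = M := by
    have h3 : |(N : ℤ) - M| < 1 := by exact_mod_cast h1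
    have := Int.abs_lt_one_iff.1 h3
    omega
  subst h2
  exact lt_irrefl _ hM

theorem IsCodedNat.exists_eq_natCast (hR : HasFiniteInitialSegments E R) {m : K}
    (h : IsCodedNat E R m) : ∃ N : ℕ, m = N := by
  obtain ⟨hm, s, hs, h⟩ := h
  rw [not_lt] at hm
  have hs0 : 0 < s := by
    by_contra hneg
    have := mul_nonneg (neg_nonneg.2 (not_lt.1 hneg)) (by linarith : 0 ≤ m + (1 + 1))
    linarith
  refine exists_eq_natCast_of_approx fun η hη => ?_
  have hden : 0 < 2 * m + 5 := by linarith
  -- The bound `s / 2` together with `w < 1` limits the walk to `M + 1 < 2 * (m + 2)`. The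
  -- accumulated error plus the tolerance at the endpoint is then below `(2 * m + 5) * δ ≤ s * η`.
  set δ := min (s / 2) (s * η / (2 * m + 5)) with hδdef
  have hδ : 0 < δ := lt_min (by linarith) (by positivity)
  have hδ1 : δ ≤ s / 2 := min_le_left _ _
  have hδ2 : δ * (2 * m + 5) ≤ s * η := by
    rw [← le_div_iff₀ hden]; exact min_le_right _ _
  obtain ⟨κ, c, a, b, v, w, hκ, hma, hmb, hab, hv, hw, hsteps⟩ := h δ hδ
  obtain ⟨w', M, hmb', hM⟩ := hsteps.exists_nat hR hmb.1 hma.1 _ a v 0 le_rfl hma (Or.inr rfl)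
    hab (by rw [abs_le]; push_cast; constructor <;> linarith)
  obtain rfl := hmb.unique hκ hmb'
  have hw1 : w < 1 := hmb.2.2.1
  rw [abs_le] at hM
  have hM1 : (M + 1 : K) * δ ≤ (M + 1) * (s / 2) :=
    mul_le_mul_of_nonneg_left hδ1 (by positivity)
  have hM2 : (M + 1 : K) < 2 * (m + 2) := by
    by_contra hcon
    have := mul_le_mul_of_nonneg_right (not_lt.1 hcon) hs0.le
    linarith
  have hM3 : (M + 1 : K) * δ < (2 * m + 4) * δ := mul_lt_mul_of_pos_right (by linarith) hδ
  refine ⟨M, ?_⟩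
  rw [abs_lt]
  constructor
  · by_contra hcon
    have := mul_le_mul_of_nonneg_left (not_lt.1 hcon) hs0.le
    linarith
  · by_contra hcon
    have := mul_le_mul_of_nonneg_left (not_lt.1 hcon) hs0.le
    linarith

/-! ### Natural numbers are coded -/

/-- If `p` is marked by `b`, then close to `p` there is a `q ∈ E` that is marked by no element of
`E` strictly between `b` and `q`. -/
theorem exists_unmarked (hR : HasFiniteInitialSegments E R) {κ b : K} (hκ : 0 < κ)
    (hκ1 : κ ≤ 1 / 2) (hb : b ∈ E) {p : K} (hp : p ∈ E) (hbp : R b p) (hlt : b < p) :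
    ∃ q ∈ E, R b q ∧ b < q ∧ q ≤ p ∧ p ≤ q + 2 * κ * (q - b) ∧
      ∀ e ∈ E, R b e → R e q → ∀ g, IsGap E R e g → q < e + κ * g → q ≤ e := by
  -- If `x` lies inside the marking interval of some intermediate `e`, replace `x` by `e` and
  -- repeat; `e` precedes `x`, so this stops. Here `e` has gap `g` with `γ ≤ κ * g ≤ g / 2`, so gaps
  -- at least double and the displacements form a geometric sum, which telescopes into the bound `2
  -- * κ * γ' - 2 * κ * γ`.
  suffices H : ∀ k : ℕ, ∀ x ∈ E, {y | y ∈ E ∧ R y x}.ncard ≤ k → R b x → b < x →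
      ∀ γ, IsGap E R x γ → ∃ q ∈ E, ∃ γ', IsGap E R q γ' ∧ R b q ∧ b < q ∧ q ≤ x ∧
        x ≤ q + 2 * κ * γ' - 2 * κ * γ ∧
        ∀ e ∈ E, R b e → R e q → ∀ g, IsGap E R e g → q < e + κ * g → q ≤ e by
    obtain ⟨γ, hγ⟩ := exists_isGap hR hp hb hbp
    obtain ⟨q, hq, γ', hγ', h1, h2, h3, h4, h5⟩ := H _ p hp le_rfl hbp hlt γ hγ
    refine ⟨q, hq, h1, h2, h3, ?_, h5⟩
    have h6 : γ' ≤ q - b := by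
      rcases hγ'.2.2 b ⟨hb, h1⟩ with h | h
      · linarith [hγ'.1]
      · linarith
    have h7 := mul_le_mul_of_nonneg_left h6 hκ.le
    have h8 := mul_pos hκ hγ.1
    linarith
  intro k
  induction k with
  | zero =>
    intro x hx hk hbx
    rw [Nat.le_zero, Set.ncard_eq_zero (hR.finite x hx)] at hk
    exact absurd ⟨hb, hbx⟩ (Set.eq_empty_iff_forall_notMem.1 hk b)
  | succ k ih =>
    intro x hx hk hbx hltx γ hγ
    by_cases hun : ∀ e ∈ E, R b e → R e x → ∀ g, IsGap E R e g → x < e + κ * g → x ≤ e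
    · exact ⟨x, hx, γ, hγ, hbx, hltx, le_rfl, by linarith, hun⟩
    push Not at hun
    obtain ⟨e, he, hbe, hex, g, hg, hxe, hex'⟩ := hun
    have hκg : κ * g ≤ g / 2 := by nlinarith [hg.1]
    have hbe' : b < e := by
      rcases hg.2.2 b ⟨hb, hbe⟩ with h | h
      · linarith [hg.1]
      · linarith [hg.1]
    have hcard : {y | y ∈ E ∧ R y e}.ncard ≤ k := by
      refine Nat.lt_succ_iff.1 (lt_of_lt_of_le (Set.ncard_lt_ncard ?_ (hR.finite x hx)) hk)
      refine ⟨fun y hy => ⟨hy.1, hR.trans y hy.1 e he x hx hy.2 hex⟩, fun h => ?_⟩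
      exact hR.irrefl e (h (show e ∈ _ from ⟨he, hex⟩)).2
    obtain ⟨q, hq, γ', hγ', h1, h2, h3, h4, h5⟩ := ih e he hcard hbe hbe' g hg
    refine ⟨q, hq, γ', hγ', h1, h2, by linarith, ?_, h5⟩
    have hγg : γ ≤ κ * g := by
      rcases hγ.2.2 e ⟨he, hex⟩ with h | h
      · linarith [hγ.1]
      · linarith
    have h6 := mul_le_mul_of_nonneg_left (hγg.trans hκg) hκ.le
    linarith

/-- A sequence `D 0, …, D i` such that every `c` in the interval marked by its last element has
exactly the marks `D 0, …, D (i - 1)` between `D 0` and `D i`, and the ratio of `c` with respect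
to `D j` is within `δ` of `t j`. -/
def IsMarkChain (E : Set K) (R : K → K → Prop) (α β κ δ : K) (t : ℕ → K) (i : ℕ) (D : ℕ → K)
    (γ : K) : Prop :=
  IsGap E R (D i) γ ∧ α ≤ D i ∧ D i + κ * γ ≤ β ∧ (∀ j ≤ i, D j ∈ E) ∧
    (∀ j k, j < k → k ≤ i → R (D j) (D k)) ∧
      ∀ c, D i < c → c < D i + κ * γ →
        (∀ j < i, ∃ v, Marks E R κ c (D j) v ∧ t j - δ < v ∧ v < t j + δ) ∧
          ∀ d v, Marks E R κ c d v → (R (D 0) d ∨ D 0 = d) → R d (D i) → ∃ j < i, d = D j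

theorem exists_isMarkChain_zero (hR : HasFiniteInitialSegments E R) {α β κ δ : K} {t : ℕ → K}
    (hαβ : α < β) (hE : ∀ x y, α ≤ x → x < y → y ≤ β → ∃ e ∈ E, x < e ∧ e < y)
    (hκ : 0 < κ) (hκ1 : κ ≤ 1 / 2) : ∃ D γ, IsMarkChain E R α β κ δ t 0 D γ := by
  -- An element without predecessor has no gap, so two points are taken and the `R`-later one is
  -- used. Both lie in the left half, so the gap is less than half of `β - α` and the marking
  -- interval stays below `β`.
  obtain ⟨x, hx, hx1, hx2⟩ := hE α ((α + β) / 2) le_rfl (by linarith) (by linarith)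
  obtain ⟨y, hy, hy1, hy2⟩ := hE x ((α + β) / 2) hx1.le hx2 (by linarith)
  obtain ⟨a, ha, z, hz, hza, ha1, ha2, hz1, hz2⟩ : ∃ a ∈ E, ∃ z ∈ E, R z a ∧ α < a ∧
      a < (α + β) / 2 ∧ α < z ∧ z < (α + β) / 2 := by
    rcases hR.total x hx y hy with h | h | h
    · exact ⟨y, hy, x, hx, h, by linarith, hy2, hx1, hx2⟩
    · exact absurd h hy1.ne
    · exact ⟨x, hx, y, hy, h, hx1, hx2, by linarith, hy2⟩
  obtain ⟨γ, hγ⟩ := exists_isGap hR ha hz hza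
  refine ⟨fun _ => a, γ, hγ, ha1.le, ?_, fun _ _ => ha, fun j k hjk hk => by omega, ?_⟩
  · have h1 : κ * γ ≤ γ / 2 := by nlinarith [hγ.1]
    have h2 := hγ.1
    rcases hγ.2.2 z ⟨hz, hza⟩ with h | h <;> linarith
  · refine fun c _ _ => ⟨fun j hj => by omega, fun d v hm had hda => ?_⟩
    rcases had with had | rfl
    · exact absurd (hR.trans a ha d hm.1 a ha had hda) (hR.irrefl a)
    · exact absurd hda (hR.irrefl _)

/-- The next element is chosen near relative position `t i` in the marking interval of `D i`, with
its own marking interval nested inside. Every `c` in the new interval therefore keeps the old marks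
and has ratio about `t i` with respect to `D i`. -/
theorem IsMarkChain.exists_succ (hR : HasFiniteInitialSegments E R) {α β κ δ : K} {t : ℕ → K}
    (hE : ∀ x y, α ≤ x → x < y → y ≤ β → ∃ e ∈ E, x < e ∧ e < y)
    (hκ : 0 < κ) (hκ1 : κ ≤ 1 / 2) (hκδ : κ ≤ δ / 4) {i : ℕ} (ht0 : δ < t i)
    (ht1 : t i + δ < 1) {D : ℕ → K} {γ : K} (h : IsMarkChain E R α β κ δ t i D γ) :
    ∃ D' γ', IsMarkChain E R α β κ δ t (i + 1) D' γ' := by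
  obtain ⟨hγ, hα, hβ, hDE, hDR, hD⟩ := h
  have hδ : 0 < δ := by linarith
  set b := D i with hbdef
  have hb : b ∈ E := hDE i le_rfl
  set w := κ * γ with hwdef
  have hw : 0 < w := mul_pos hκ hγ.1
  have hwγ : w ≤ γ / 2 := by nlinarith [hγ.1]
  have hδw : 0 < δ * w := mul_pos hδ hw
  have htw : δ * w < t i * w := mul_lt_mul_of_pos_right ht0 hw
  have htw1 : (t i + δ) * w < 1 * w := mul_lt_mul_of_pos_right ht1 hw
  have hκw : κ * w ≤ δ / 4 * w := mul_le_mul_of_nonneg_right hκδ hw.le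
  -- Error budget in units of `δ * w`: at most `1/4` from choosing `p`, `1/2` from retreating to the
  -- unmarked `q`, and `1/4` from the length of the marking interval of `q`.
  obtain ⟨p, hp, hp1, hp2⟩ := hE (b + t i * w) (b + t i * w + δ * w / 4)
    (by linarith) (by linarith) (by linarith)
  have hbp' : b < p := by linarith
  -- `p` is closer to `b` than the gap of `b`, so it cannot precede `b`.
  have hbp : R b p := by
    rcases hR.total b hb p hp with h | h | h
    · exact h
    · exact absurd h hbp'.ne
    · rcases hγ.2.2 p ⟨hp, h⟩ with h | h <;> linarith
  obtain ⟨q, hq, hbq, hbq', hqp, hpq, hun⟩ := exists_unmarked hR hκ hκ1 hb hp hbp hbp'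
  obtain ⟨γ', hγ'⟩ := exists_isGap hR hq hb hbq
  have hγ'w : γ' ≤ q - b := by
    rcases hγ'.2.2 b ⟨hb, hbq⟩ with h | h
    · linarith [hγ'.1]
    · linarith
  have hqw : q - b ≤ w := by linarith
  have h1 := mul_le_mul_of_nonneg_left (hγ'w.trans hqw) hκ.le
  have h2 := mul_le_mul_of_nonneg_left hqw hκ.le
  have h3 : κ * γ' ≤ γ' / 2 := by nlinarith [hγ'.1]
  have hγ'0 := hγ'.1
  have hold : ∀ j ≤ i, Function.update D (i + 1) q j = D j := fun j hj =>
    Function.update_of_ne (by omega) _ _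
  have hnew : Function.update D (i + 1) q (i + 1) = q := Function.update_self _ _ _
  refine ⟨Function.update D (i + 1) q, γ', ?_⟩
  unfold IsMarkChain
  rw [hnew]
  refine ⟨hγ', by linarith, by linarith, ?_, ?_, ?_⟩
  · intro j hj
    rcases Nat.le_succ_iff.1 hj with hj | rfl
    · rw [hold j hj]; exact hDE j hj
    · rwa [hnew]
  · intro j k hjk hk
    rw [hold j (by omega)]
    rcases Nat.le_succ_iff.1 hk with hk | rfl
    · rw [hold k hk]; exact hDR j k hjk hk
    · rw [hnew]
      rcases (Nat.lt_succ_iff.1 hjk).eq_or_lt with rfl | hji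
      · exact hbq
      · exact hR.trans _ (hDE j hji.le) b hb q hq (hDR j i hji le_rfl) hbq
  · intro c hc1 hc2
    obtain ⟨hm, hall⟩ := hD c (by linarith) (by linarith)
    constructor
    · intro j hj
      rw [hold j (by omega)]
      rcases (Nat.lt_succ_iff.1 hj).eq_or_lt with rfl | hji
      · have hv1 : t j - δ < (c - b) / w := by rw [lt_div_iff₀ hw]; linarith
        have hv2 : (c - b) / w < t j + δ := by rw [div_lt_iff₀ hw]; linarith
        refine ⟨(c - b) / w, ⟨hb, by linarith, by linarith, γ, hγ, ?_⟩, hv1, hv2⟩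
        rw [← hwdef, div_mul_cancel₀ _ hw.ne']; ring
      · exact hm j hji
    · intro d v hdm h0d hdq
      rw [hold 0 (Nat.zero_le _)] at h0d
      rcases hR.total d hdm.1 b hb with hdb | rfl | hbd
      · obtain ⟨j, hj, rfl⟩ := hall d v hdm h0d hdb
        exact ⟨j, by omega, (hold j hj.le).symm⟩
      · exact ⟨i, by omega, (hold i le_rfl).symm⟩
      -- A mark `d` strictly between `b` and `q` would lie at or to the right of `q`, since `q` is
      -- unmarked. As `d < c`, it would then be within `κ * γ'` of `q`, less than the gap of `q`.
      · exfalso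
        obtain ⟨hd, hv0, hv1, g, hg, hc⟩ := hdm
        have hκg : 0 < κ * g := mul_pos hκ hg.1
        have h4 : v * (κ * g) < 1 * (κ * g) := mul_lt_mul_of_pos_right hv1 hκg
        have h5 : 0 < v * (κ * g) := mul_pos hv0 hκg
        have hqd := hun d hd hbd hdq g hg (by linarith)
        rcases hγ'.2.2 d ⟨hd, hdq⟩ with h | h <;> linarith

theorem isCodedNat_natCast (hR : HasFiniteInitialSegments E R) {α β : K} (hαβ : α < β)
    (hE : ∀ x y, α ≤ x → x < y → y ≤ β → ∃ e ∈ E, x < e ∧ e < y) (m : ℕ) :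
    IsCodedNat E R (m : K) := by
  have hm : (0 : K) < m + 2 := by positivity
  refine ⟨not_lt.2 (Nat.cast_nonneg m), 1 / (m + 2), by field_simp; ring, fun δ₀ hδ₀ => ?_⟩
  set s : K := 1 / (m + 2) with hs
  have hs0 : 0 < s := by positivity
  have hsm : s * (m + 2) = 1 := by rw [hs]; field_simp
  -- Consecutive ratios each carry an error `δ`, hence the half of `δ₀`. The bound `s / 2` keeps
  -- every target `s * (i + 1)` with `i < m` more than `δ` away from `0` and `1`.
  set δ := min (δ₀ / 2) (s / 2) with hδdef
  have hδ : 0 < δ := lt_min (by linarith) (by linarith)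
  have hδ1 : δ ≤ δ₀ / 2 := min_le_left _ _
  have hδ2 : δ ≤ s / 2 := min_le_right _ _
  set κ := min (δ / 4) (1 / 2) with hκdef
  have hκ : 0 < κ := lt_min (by linarith) (by norm_num)
  have hκ1 : κ ≤ 1 / 2 := min_le_right _ _
  have hκδ : κ ≤ δ / 4 := min_le_left _ _
  have hchain : ∀ i ≤ m, ∃ D γ, IsMarkChain E R α β κ δ (fun j => s * (j + 1)) i D γ := by
    intro i
    induction i with
    | zero => exact fun _ => exists_isMarkChain_zero hR hαβ hE hκ hκ1
    | succ i ih =>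
      intro hi
      obtain ⟨D, γ, h⟩ := ih (by omega)
      have hi' : (i : K) + 1 ≤ m := by exact_mod_cast hi
      have h1 := mul_le_mul_of_nonneg_left hi' hs0.le
      have h2 : 0 ≤ s * i := by positivity
      refine h.exists_succ hR hE hκ hκ1 hκδ ?_ ?_
      · linarith
      · linarith
  obtain ⟨D, γ, hγ, hα, hβ, hDE, hDR, hD⟩ := hchain m le_rfl
  have hw : 0 < κ * γ := mul_pos hκ hγ.1
  have hv0 : 0 < s * (m + 1) := by positivity
  have hv1 : s * (m + 1) < 1 := by linarith
  -- The chain controls only the ratios at `D j` for `j < m`. The last entry is fixed by placing `c`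
  -- at ratio exactly `s * (m + 1)` over `D m`.
  obtain ⟨hmark, hall⟩ := hD (D m + s * (m + 1) * (κ * γ))
    (by linarith [mul_pos hv0 hw]) (by linarith [mul_lt_mul_of_pos_right hv1 hw])
  set c := D m + s * (m + 1) * (κ * γ) with hc
  have hlast : Marks E R κ c (D m) (s * (m + 1)) := ⟨hDE m le_rfl, hv0, hv1, γ, hγ, hc⟩
  have hmark' : ∀ j ≤ m, ∃ v, Marks E R κ c (D j) v ∧ s * (j + 1) - δ < v ∧
      v < s * (j + 1) + δ := by
    intro j hj
    rcases hj.eq_or_lt with rfl | hj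
    · exact ⟨_, hlast, by linarith, by linarith⟩
    · exact hmark j hj
  obtain ⟨v, hv, hv1, hv2⟩ := hmark' 0 (Nat.zero_le _)
  have hle : ∀ j ≤ m, R (D j) (D m) ∨ D j = D m := fun j hj => by
    rcases hj.eq_or_lt with rfl | hj
    · exact Or.inr rfl
    · exact Or.inl (hDR j m hj le_rfl)
  push_cast at hv1 hv2
  refine ⟨κ, c, D 0, D m, v, s * (m + 1), hκ, hv, hlast, hle 0 (Nat.zero_le _),
    ⟨by linarith, by linarith⟩, ⟨by linarith, by linarith⟩, ?_⟩
  rintro d u ⟨hdu, had, hdb⟩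
  obtain ⟨j, hj, rfl⟩ := hall d u hdu had hdb
  obtain ⟨u', hu', h1, h2⟩ := hmark' j hj.le
  obtain rfl := hdu.unique hκ hu'
  obtain ⟨v', hv', h3, h4⟩ := hmark' (j + 1) hj
  push_cast at h3 h4
  exact ⟨D (j + 1), v', hv', hDR j (j + 1) (Nat.lt_succ_self j) hj, hle _ hj, by linarith,
    by linarith⟩

theorem isCodedNat_iff (hR : HasFiniteInitialSegments E R) {α β : K} (hαβ : α < β)
    (hE : ∀ x y, α ≤ x → x < y → y ≤ β → ∃ e ∈ E, x < e ∧ e < y) (m : K) :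
    IsCodedNat E R m ↔ ∃ N : ℕ, m = N :=
  ⟨fun h => h.exists_eq_natCast hR, fun ⟨N, hN⟩ => hN ▸ isCodedNat_natCast hR hαβ hE N⟩

end Coding

/-! ### Closure properties of parameter-free definability -/

section Definability

open FirstOrder FirstOrder.Language

/-- A predicate on tuples that is given by a first-order formula without parameters. -/
def FormulaDefinable (L : FirstOrder.Language.{0, 0}) {M α : Type} (S : L.Structure M)
    (P : (α → M) → Prop) : Prop :=
  ∃ φ : L.Formula α, ∀ v, φ.Realize v ↔ P v

/-- A function on tuples that is given by a first-order term without parameters. -/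
def TermRealizable (L : FirstOrder.Language.{0, 0}) {M α : Type} (S : L.Structure M)
    (t : (α → M) → M) : Prop :=
  ∃ τ : L.Term α, ∀ v, τ.realize v = t v

namespace FormulaDefinable

variable {L : FirstOrder.Language.{0, 0}} {M α : Type} {S : L.Structure M} {P Q : (α → M) → Prop}

theorem complement (hP : FormulaDefinable L S P) : FormulaDefinable L S fun v => ¬ P v := by
  obtain ⟨φ, hφ⟩ := hP
  exact ⟨φ.not, fun v => by rw [Formula.realize_not, hφ]⟩

theorem conj (hP : FormulaDefinable L S P) (hQ : FormulaDefinable L S Q) :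
    FormulaDefinable L S fun v => P v ∧ Q v := by
  obtain ⟨φ, hφ⟩ := hP
  obtain ⟨ψ, hψ⟩ := hQ
  exact ⟨φ ⊓ ψ, fun v => by rw [Formula.realize_inf, hφ, hψ]⟩

theorem of_iff (hP : FormulaDefinable L S P) (h : ∀ v, P v ↔ Q v) : FormulaDefinable L S Q := by
  obtain ⟨φ, hφ⟩ := hP
  exact ⟨φ, fun v => (hφ v).trans (h v)⟩

theorem disj (hP : FormulaDefinable L S P) (hQ : FormulaDefinable L S Q) :
    FormulaDefinable L S fun v => P v ∨ Q v :=
  (hP.complement.conj hQ.complement).complement.of_iff fun v => by tauto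

theorem impl (hP : FormulaDefinable L S P) (hQ : FormulaDefinable L S Q) :
    FormulaDefinable L S fun v => P v → Q v :=
  (hP.complement.disj hQ).of_iff fun v => by tauto

theorem equiv (hP : FormulaDefinable L S P) (hQ : FormulaDefinable L S Q) :
    FormulaDefinable L S fun v => (P v ↔ Q v) :=
  ((hP.impl hQ).conj (hQ.impl hP)).of_iff fun v => by tauto

theorem forall_finite {ι : Type} [Finite ι] {P : ι → (α → M) → Prop}
    (hP : ∀ i, FormulaDefinable L S (P i)) : FormulaDefinable L S fun v => ∀ i, P i v := by
  choose φ hφ using hP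
  refine ⟨BoundedFormula.iInf φ, fun v => ?_⟩
  rw [Formula.Realize, BoundedFormula.realize_iInf]
  exact forall_congr' fun i => hφ i v

theorem exists_tuple {ι : Type} [Finite ι] {P : (α → M) → (ι → M) → Prop}
    (hP : FormulaDefinable L S fun v : α ⊕ ι → M => P (fun a => v (.inl a)) fun i => v (.inr i)) :
    FormulaDefinable L S fun v => ∃ u : ι → M, P v u := by
  obtain ⟨φ, hφ⟩ := hP
  refine ⟨φ.iExs ι, fun v => ?_⟩
  rw [Formula.realize_iExs]
  exact exists_congr fun u => hφ _

theorem ex {P : (α → M) → M → Prop}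
    (hP : FormulaDefinable L S fun v : α ⊕ Unit → M => P (fun a => v (.inl a)) (v (.inr ()))) :
    FormulaDefinable L S fun v => ∃ x, P v x :=
  (exists_tuple (P := fun v u => P v (u ())) hP).of_iff fun _ =>
    ⟨fun ⟨u, hu⟩ => ⟨u (), hu⟩, fun ⟨x, hx⟩ => ⟨fun _ => x, hx⟩⟩

theorem all {P : (α → M) → M → Prop}
    (hP : FormulaDefinable L S fun v : α ⊕ Unit → M => P (fun a => v (.inl a)) (v (.inr ()))) :
    FormulaDefinable L S fun v => ∀ x, P v x :=
  (ex (P := fun v x => ¬ P v x) hP.complement).complement.of_iff fun v => by push Not; rfl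

theorem equal {t u : (α → M) → M} (ht : TermRealizable L S t) (hu : TermRealizable L S u) :
    FormulaDefinable L S fun v => t v = u v := by
  obtain ⟨τ, hτ⟩ := ht
  obtain ⟨σ, hσ⟩ := hu
  exact ⟨Term.equal τ σ, fun v => by rw [Formula.realize_equal, hτ, hσ]⟩

end FormulaDefinable

theorem TermRealizable.var {L : FirstOrder.Language.{0, 0}} {M α : Type} {S : L.Structure M} (a : α) :
    TermRealizable L S fun v : α → M => v a :=
  ⟨Term.var a, fun _ => rfl⟩

variable {K : Subfield ℝ} {D : Set K} {n : ℕ} {f : (Fin n → D) → K} {α : Type}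

/-- Definability of a predicate in the expansion `(K, f)`, without parameters. -/
abbrev GraphDefinable (f : (Fin n → D) → K) (P : (α → K) → Prop) : Prop :=
  FormulaDefinable (orderedRingGraph n) (fieldExpansion K D n f) P

/-- Functions given by terms of the expansion `(K, f)`, without parameters. -/
abbrev GraphTerm (f : (Fin n → D) → K) (t : (α → K) → K) : Prop :=
  TermRealizable (orderedRingGraph n) (fieldExpansion K D n f) t

namespace GraphTerm

variable {t u : (α → K) → K}

theorem zero : GraphTerm f fun _ : α → K => 0 :=
  ⟨Term.func (L := orderedRingGraph n) ringFunc.zero ![], fun _ => rfl⟩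

theorem one : GraphTerm f fun _ : α → K => 1 :=
  ⟨Term.func (L := orderedRingGraph n) ringFunc.one ![], fun _ => rfl⟩

theorem neg (ht : GraphTerm f t) : GraphTerm f fun v => - t v := by
  obtain ⟨τ, hτ⟩ := ht
  refine ⟨Term.func (L := orderedRingGraph n) ringFunc.neg ![τ], fun v => ?_⟩
  change _ = - t v
  rw [← hτ]
  rfl

theorem add (ht : GraphTerm f t) (hu : GraphTerm f u) : GraphTerm f fun v => t v + u v := by
  obtain ⟨τ, hτ⟩ := ht
  obtain ⟨σ, hσ⟩ := hu
  refine ⟨Term.func (L := orderedRingGraph n) ringFunc.add ![τ, σ], fun v => ?_⟩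
  change _ = _ + _
  rw [← hτ, ← hσ]
  rfl

theorem mul (ht : GraphTerm f t) (hu : GraphTerm f u) : GraphTerm f fun v => t v * u v := by
  obtain ⟨τ, hτ⟩ := ht
  obtain ⟨σ, hσ⟩ := hu
  refine ⟨Term.func (L := orderedRingGraph n) ringFunc.mul ![τ, σ], fun v => ?_⟩
  change _ = _ * _
  rw [← hτ, ← hσ]
  rfl

theorem sub (ht : GraphTerm f t) (hu : GraphTerm f u) : GraphTerm f fun v => t v - u v := by
  simp only [sub_eq_add_neg]
  exact add ht (neg hu)

end GraphTerm

namespace GraphDefinable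

variable {t u : (α → K) → K}

theorem lt (ht : GraphTerm f t) (hu : GraphTerm f u) : GraphDefinable f fun v => t v < u v := by
  obtain ⟨τ, hτ⟩ := ht
  obtain ⟨σ, hσ⟩ := hu
  refine ⟨Relations.formula (L := orderedRingGraph n) OrderedRingGraphRel.lt ![τ, σ],
    fun v => ?_⟩
  refine (@Formula.realize_rel _ _ (fieldExpansion K D n f) _ _ _ _ _).trans ?_
  let _ := fieldExpansion K D n f
  change τ.realize v < σ.realize v ↔ t v < u v
  rw [hτ, hσ]

theorem le (ht : GraphTerm f t) (hu : GraphTerm f u) : GraphDefinable f fun v => t v ≤ u v :=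
  (lt hu ht).complement.of_iff fun _ => not_lt

theorem graph (x : Fin n → α) (y : α) :
    GraphDefinable f fun v => ∃ d : Fin n → D, (∀ i, v (x i) = d i) ∧ v y = f d := by
  refine ⟨Relations.formula (L := orderedRingGraph n) OrderedRingGraphRel.graph
    (Fin.snoc (α := fun _ => (orderedRingGraph n).Term α) (fun i => Term.var (x i)) (Term.var y)),
    fun v => ?_⟩
  refine (@Formula.realize_rel _ _ (fieldExpansion K D n f) _ _ _ _ _).trans ?_
  simp only [Structure.RelMap, Fin.snoc_castSucc, Fin.snoc_last, Term.realize_var]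

end GraphDefinable

end Definability

/-! ### Levels: an exhaustion of the values of `f` by finite sets -/

section Levels

variable {K : Subfield ℝ} {D : Set K} {n : ℕ} {f : (Fin n → D) → K}

/-- `d ∈ D` has absolute value at most `t` and distance at least `1 / t` to the other points
of `D`. -/
def IsLevel (D : Set K) (t d : K) : Prop :=
  d ∈ D ∧ d ≤ t ∧ -d ≤ t ∧ ∀ x, x ∈ D ∧ ¬ x = d → 1 ≤ t * (x - d) ∨ 1 ≤ t * (d - x)

/-- `y` is the value of `f` at a tuple of points of level `t`. -/
def IsLevelValue (f : (Fin n → D) → K) (t y : K) : Prop :=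
  ∃ u : Fin n → K, (∀ i, IsLevel D t (u i)) ∧ ∃ d : Fin n → D, (∀ i, u i = d i) ∧ y = f d

/-- The order on the values of `f` by the level at which they first occur, and by size for values
that occur at the same levels. -/
def LevelLT (f : (Fin n → D) → K) (x y : K) : Prop :=
  (∃ t, IsLevelValue f t x ∧ ¬ IsLevelValue f t y) ∨
    ((∀ t, IsLevelValue f t x ↔ IsLevelValue f t y) ∧ x < y)

theorem IsLevel.nonneg {t d : K} (h : IsLevel D t d) : 0 ≤ t := by
  linarith [h.2.1, h.2.2.1]

theorem IsLevel.mono {t t' d : K} (h : IsLevel D t d) (htt' : t ≤ t') : IsLevel D t' d := by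
  have ht := h.nonneg
  refine ⟨h.1, h.2.1.trans htt', h.2.2.1.trans htt', fun x hx => ?_⟩
  rcases h.2.2.2 x hx with h | h
  · refine Or.inl (h.trans (mul_le_mul_of_nonneg_right htt' ?_))
    by_contra hneg
    nlinarith
  · refine Or.inr (h.trans (mul_le_mul_of_nonneg_right htt' ?_))
    by_contra hneg
    nlinarith

/-- Points of level `t` are bounded and pairwise at least `1 / t` apart, so after scaling by `t`
their integer parts are distinct and bounded. -/
theorem finite_setOf_isLevel (D : Set K) (t : K) : {d | IsLevel D t d}.Finite := by
  refine Set.Finite.of_injOn (f := fun d : K => ⌊((t * d : K) : ℝ)⌋)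
    (t := Set.Icc ⌊((-(t * t) : K) : ℝ)⌋ ⌊((t * t : K) : ℝ)⌋) ?_ ?_ (Set.finite_Icc _ _)
  · intro d hd
    have ht := hd.nonneg
    constructor
    · refine Int.floor_le_floor ?_
      have : -(t * t) ≤ t * d := by nlinarith [hd.2.2.1]
      exact_mod_cast this
    · refine Int.floor_le_floor ?_
      have : t * d ≤ t * t := by nlinarith [hd.2.1]
      exact_mod_cast this
  · intro d hd x hx hdx
    by_contra hne
    have h := Int.abs_sub_lt_one_of_floor_eq_floor hdx
    rw [abs_lt] at h
    obtain ⟨h1, h2⟩ := h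
    have h1' : -1 < t * d - t * x := by exact_mod_cast h1
    have h2' : t * d - t * x < 1 := by exact_mod_cast h2
    rcases hd.2.2.2 x ⟨hx.1, fun h => hne h.symm⟩ with h | h <;> linarith

theorem exists_isLevel (hD : DiscreteTopology D) {d : K} (hd : d ∈ D) : ∃ t, IsLevel D t d := by
  obtain ⟨ε, hε, hball⟩ := Metric.exists_ball_inter_eq_singleton_of_mem_discrete ⟨hD⟩ hd
  -- Taking the level to be a natural number ensures that it lies in `K`.
  obtain ⟨N, hN⟩ := exists_nat_gt (max (max (d : ℝ) (-d : ℝ)) (1 / ε))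
  have h1 : (d : ℝ) ≤ N := ((le_max_left _ _).trans (le_max_left _ _)).trans hN.le
  have h2 : (-d : ℝ) ≤ N := ((le_max_right _ _).trans (le_max_left _ _)).trans hN.le
  have h3 : 1 < N * ε := (div_lt_iff₀ hε).1 ((le_max_right _ _).trans_lt hN)
  refine ⟨(N : K), hd, by exact_mod_cast h1, by exact_mod_cast h2, ?_⟩
  rintro x ⟨hx, hxd⟩
  have hdist : ε ≤ |(x : ℝ) - d| := by
    by_contra hlt
    have : x ∈ Metric.ball d ε ∩ D := ⟨not_le.1 hlt, hx⟩
    rw [hball] at this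
    exact hxd this
  have hN0 : (0 : ℝ) ≤ N := Nat.cast_nonneg N
  rcases le_abs.1 hdist with h | h
  · left
    have : (1 : ℝ) ≤ N * (x - d) := by nlinarith
    exact_mod_cast this
  · right
    have : (1 : ℝ) ≤ N * (d - x) := by nlinarith
    exact_mod_cast this

theorem IsLevelValue.mono {t t' y : K} (h : IsLevelValue f t y) (htt' : t ≤ t') :
    IsLevelValue f t' y := by
  obtain ⟨u, hu, h⟩ := h
  exact ⟨u, fun i => (hu i).mono htt', h⟩

theorem finite_setOf_isLevelValue (f : (Fin n → D) → K) (t : K) :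
    {y | IsLevelValue f t y}.Finite := by
  have hfin : {d : Fin n → D | ∀ i, d i ∈ {e : D | IsLevel D t e}}.Finite :=
    Set.Finite.pi' fun _ =>
      (finite_setOf_isLevel D t).preimage (f := ((↑) : D → K)) Subtype.val_injective.injOn
  refine (hfin.image f).subset ?_
  rintro y ⟨u, hu, d, hd, rfl⟩
  exact ⟨d, fun i => by simpa [← hd i] using hu i, rfl⟩

theorem exists_isLevelValue (hD : DiscreteTopology D) (d : Fin n → D) :
    ∃ t, IsLevelValue f t (f d) := by
  choose t ht using fun i => exists_isLevel hD (d i).2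
  obtain ⟨T, hT⟩ := Finite.exists_le t
  exact ⟨T, fun i => d i, fun i => (ht i).mono (hT i), d, fun _ => rfl, rfl⟩

theorem hasFiniteInitialSegments_levelLT (hD : DiscreteTopology D) :
    HasFiniteInitialSegments (Set.range f) (LevelLT f) where
  irrefl x := by
    rintro (⟨t, h, h'⟩ | ⟨-, h⟩)
    · exact h' h
    · exact lt_irrefl _ h
  trans x _ y _ z _ := by
    rintro (⟨t, h, h'⟩ | ⟨h, h'⟩) (⟨t', k, k'⟩ | ⟨k, k'⟩)
    · refine Or.inl ⟨t, h, fun hz => ?_⟩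
      rcases le_total t t' with hle | hle
      · exact k' (hz.mono hle)
      · exact h' (k.mono hle)
    · exact Or.inl ⟨t, h, fun hz => h' ((k t).2 hz)⟩
    · exact Or.inl ⟨t', (h t').2 k, k'⟩
    · exact Or.inr ⟨fun t => (h t).trans (k t), h'.trans k'⟩
  total x _ y _ := by
    by_cases h : ∃ t, IsLevelValue f t x ∧ ¬ IsLevelValue f t y
    · exact Or.inl (Or.inl h)
    by_cases h' : ∃ t, IsLevelValue f t y ∧ ¬ IsLevelValue f t x
    · exact Or.inr (Or.inr (Or.inl h'))
    push Not at h h'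
    rcases lt_trichotomy x y with hxy | hxy | hxy
    · exact Or.inl (Or.inr ⟨fun t => ⟨h t, h' t⟩, hxy⟩)
    · exact Or.inr (Or.inl hxy)
    · exact Or.inr (Or.inr (Or.inr ⟨fun t => ⟨h' t, h t⟩, hxy⟩))
  finite y hy := by
    obtain ⟨d, rfl⟩ := hy
    obtain ⟨t, ht⟩ := exists_isLevelValue (f := f) hD d
    refine (finite_setOf_isLevelValue f t).subset ?_
    rintro x ⟨-, ⟨t', h, h'⟩ | ⟨h, -⟩⟩
    · rcases le_total t t' with hle | hle
      · exact absurd (ht.mono hle) h'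
      · exact h.mono hle
    · exact (h t).2 ht

theorem SomewhereDense.exists_interval {S : Set K} (hS : SomewhereDense S) :
    ∃ α β : K, α < β ∧ ∀ x y, α ≤ x → x < y → y ≤ β → ∃ e ∈ S, x < e ∧ e < y := by
  obtain ⟨a, ha⟩ := hS
  obtain ⟨ε, hε, hball⟩ := Metric.isOpen_iff.1 isOpen_interior a ha
  -- The radius `ε` is real and need not belong to `K`; a smaller positive rational does.
  obtain ⟨q, hq0, hqε⟩ := exists_rat_btwn hε
  have hq0' : (0 : K) < q := by exact_mod_cast hq0
  refine ⟨a, a + q, by linarith, fun x y hx hxy hy => ?_⟩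
  have hmem : (x + y) / 2 ∈ Metric.ball a ε := by
    have h1 : a ≤ (x + y) / 2 := by linarith
    have h2 : (x + y) / 2 ≤ a + q := by linarith
    have h1' : (a : ℝ) ≤ ((x + y) / 2 : K) := by exact_mod_cast h1
    have h2' : (((x + y) / 2 : K) : ℝ) ≤ a + q := by exact_mod_cast h2
    change |(((x + y) / 2 : K) : ℝ) - a| < ε
    rw [abs_lt]
    constructor <;> linarith
  have hxy' : (0 : ℝ) < (((y - x) / 2 : K) : ℝ) := by
    have : 0 < (y - x) / 2 := by linarith
    exact_mod_cast this
  obtain ⟨e, he, hdist⟩ := Metric.mem_closure_iff.1 (interior_subset (hball hmem)) _ hxy'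
  change |(((x + y) / 2 : K) : ℝ) - e| < _ at hdist
  rw [abs_lt] at hdist
  have h1 : -((y - x) / 2) < (x + y) / 2 - e := by exact_mod_cast hdist.1
  have h2 : (x + y) / 2 - e < (y - x) / 2 := by exact_mod_cast hdist.2
  exact ⟨e, he, by linarith, by linarith⟩

end Levels

/-! ### Definability of the level order and of the coding condition -/

section Definability

variable {K : Subfield ℝ} {D : Set K} {n : ℕ} {f : (Fin n → D) → K} {α : Type}

namespace GraphDefinable

open FormulaDefinable TermRealizable GraphTerm

/-- `D` is read off the diagonal of the domain of `f`, which requires at least one coordinate. -/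
theorem mem_domain [NeZero n] (x : α) : GraphDefinable f fun v => v x ∈ D := by
  have h : GraphDefinable f fun v : α → K =>
      ∃ y, ∃ d : Fin n → D, (∀ i, v x = d i) ∧ y = f d :=
    ex (graph (fun _ => Sum.inl x) (Sum.inr ()))
  refine h.of_iff fun v => ⟨?_, fun h => ?_⟩
  · rintro ⟨y, d, hd, -⟩
    rw [hd 0]
    exact (d 0).2
  · exact ⟨_, fun _ => ⟨v x, h⟩, fun _ => rfl, rfl⟩

theorem mem_range (y : α) : GraphDefinable f fun v => v y ∈ Set.range f := by
  have h : GraphDefinable f fun v : α → K =>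
      ∃ u : Fin n → K, ∃ d : Fin n → D, (∀ i, u i = d i) ∧ v y = f d :=
    exists_tuple (graph (fun i => Sum.inr i) (Sum.inl y))
  refine h.of_iff fun v => ⟨?_, ?_⟩
  · rintro ⟨u, d, -, h⟩
    exact ⟨d, h.symm⟩
  · rintro ⟨d, h⟩
    exact ⟨fun i => d i, d, fun _ => rfl, h.symm⟩

/-- Here and below the proof term mirrors the syntax of the definition, which is written with just
the connectives and terms available; unification supplies the variables. -/
theorem isLevel [NeZero n] (t d : α) : GraphDefinable f fun v => IsLevel D (v t) (v d) := by
  refine conj (mem_domain _) <| conj (le (var _) (var _)) <| conj (le (neg (var _)) (var _)) <|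
    all <| impl (conj (mem_domain _) (complement (equal (var _) (var _)))) <|
      disj (le one (mul (var _) (sub (var _) (var _)))) (le one (mul (var _) (sub (var _) (var _))))

theorem isLevelValue [NeZero n] (t y : α) :
    GraphDefinable f fun v => IsLevelValue f (v t) (v y) := by
  refine exists_tuple <| conj (forall_finite fun _ => isLevel _ _) (graph _ _)

theorem levelLT [NeZero n] (x y : α) : GraphDefinable f fun v => LevelLT f (v x) (v y) := by
  refine disj (ex <| conj (isLevelValue _ _) (complement (isLevelValue _ _)))
    (conj (all <| equiv (isLevelValue _ _) (isLevelValue _ _)) (lt (var _) (var _)))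

variable {E : Set K} {R : K → K → Prop}

theorem isGap (hE : ∀ {α : Type} (x : α), GraphDefinable f fun v => v x ∈ E)
    (hR : ∀ {α : Type} (x y : α), GraphDefinable f fun v => R (v x) (v y)) (d g : α) :
    GraphDefinable f fun v => IsGap E R (v d) (v g) := by
  refine conj (lt zero (var _)) <| conj
    (ex <| conj (hE _) <| conj (hR _ _) <| disj (equal (var _) (add (var _) (var _)))
      (equal (var _) (sub (var _) (var _)))) <|
    all <| impl (conj (hE _) (hR _ _)) <|
      disj (le (add (var _) (var _)) (var _)) (le (var _) (sub (var _) (var _)))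

theorem marks (hE : ∀ {α : Type} (x : α), GraphDefinable f fun v => v x ∈ E)
    (hR : ∀ {α : Type} (x y : α), GraphDefinable f fun v => R (v x) (v y)) (κ c d r : α) :
    GraphDefinable f fun v => Marks E R (v κ) (v c) (v d) (v r) := by
  refine conj (hE _) <| conj (lt zero (var _)) <| conj (lt (var _) one) <|
    ex <| conj (isGap hE hR _ _) <|
      equal (var _) (add (var _) (mul (var _) (mul (var _) (var _))))

theorem codesSteps (hE : ∀ {α : Type} (x : α), GraphDefinable f fun v => v x ∈ E)
    (hR : ∀ {α : Type} (x y : α), GraphDefinable f fun v => R (v x) (v y)) (s δ κ c a b : α) :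
    GraphDefinable f fun v => CodesSteps E R (v s) (v δ) (v κ) (v c) (v a) (v b) := by
  refine all <| all <| impl (conj (marks hE hR _ _ _ _) (conj (disj (hR _ _) (equal (var _) (var _)))
    (hR _ _))) <| ex <| ex <| conj (marks hE hR _ _ _ _) <| conj (hR _ _) <|
      conj (disj (hR _ _) (equal (var _) (var _))) <| conj
        (lt (sub (add (var _) (var _)) (var _)) (var _))
        (lt (var _) (add (add (var _) (var _)) (var _)))

theorem isCodedNat (hE : ∀ {α : Type} (x : α), GraphDefinable f fun v => v x ∈ E)
    (hR : ∀ {α : Type} (x y : α), GraphDefinable f fun v => R (v x) (v y)) (m : α) :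
    GraphDefinable f fun v => IsCodedNat E R (v m) := by
  refine conj (complement (lt (var _) zero)) <| ex <|
    conj (equal (mul (var _) (add (var _) (add one one))) one) <| all <|
      impl (lt zero (var _)) <| ex <| ex <| ex <| ex <| ex <| ex <| conj (lt zero (var _)) <|
      conj (marks hE hR _ _ _ _) <| conj (marks hE hR _ _ _ _) <|
      conj (disj (hR _ _) (equal (var _) (var _))) <|
      conj (conj (lt (sub (var _) (var _)) (var _)) (lt (var _) (add (var _) (var _)))) <|
      conj (conj (lt (sub (mul (var _) (add (var _) one)) (var _)) (var _))
        (lt (var _) (add (mul (var _) (add (var _) one)) (var _)))) <|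
      codesSteps hE hR _ _ _ _ _ _

end GraphDefinable

end Definability

/-- `Set.univ` is the set of allowed parameters: definable means definable with parameters. -/
theorem theoremA (K : Subfield ℝ) (D : Set K) (hD : DiscreteTopology D) (n : ℕ)
    (f : (Fin n → D) → K) (hf : SomewhereDense (Set.range f)) :
    letI : (orderedRingGraph n).Structure K := fieldExpansion K D n f
    (Set.univ : Set K).Definable₁ (orderedRingGraph n) (Set.range ((↑) : ℤ → K)) := by
  obtain ⟨α, β, hαβ, hdense⟩ := hf.exists_interval
  -- For `n = 0` the range has at most one point, while density gives two distinct values.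
  have hn : NeZero n := by
    refine ⟨?_⟩
    rintro rfl
    obtain ⟨-, ⟨d, rfl⟩, h1, h2⟩ := hdense α β le_rfl hαβ le_rfl
    obtain ⟨-, ⟨d', rfl⟩, -, h3⟩ := hdense α (f d) le_rfl h1 h2.le
    exact absurd h3 (by rw [Subsingleton.elim d' d]; exact lt_irrefl _)
  have hnat := isCodedNat_iff (hasFiniteInitialSegments_levelLT (f := f) hD) hαβ hdense
  have hcoded : ∀ {α : Type} (m : α),
      GraphDefinable f fun v => IsCodedNat (Set.range f) (LevelLT f) (v m) := fun m =>
    GraphDefinable.isCodedNat GraphDefinable.mem_range GraphDefinable.levelLT m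
  have hint : GraphDefinable f fun v : Fin 1 → K => v 0 ∈ Set.range ((↑) : ℤ → K) := by
    -- The definability lemma for the coding condition applies to variables only, so `- v 0` is
    -- named by a quantified `x`.
    have hneg : GraphDefinable f fun v : Fin 1 → K =>
        ∃ x, x = - v 0 ∧ IsCodedNat (Set.range f) (LevelLT f) x :=
      .ex <| .conj (.equal (.var _) (GraphTerm.neg (.var _))) (hcoded _)
    refine ((hcoded 0).disj hneg).of_iff fun v => ?_
    simp only [hnat, Set.mem_range]
    constructor
    · rintro (⟨N, hN⟩ | ⟨x, hx, N, hN⟩)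
      · exact ⟨N, by rw [hN]; norm_cast⟩
      · refine ⟨-N, ?_⟩
        rw [← neg_eq_iff_eq_neg.2 hx, hN]
        push_cast
        rfl
    · rintro ⟨z, hz⟩
      rcases Int.eq_nat_or_neg z with ⟨N, rfl | rfl⟩
      · exact Or.inl ⟨N, by rw [← hz]; norm_cast⟩
      · exact Or.inr ⟨N, by rw [← hz]; push_cast; rw [neg_neg], N, rfl⟩
  obtain ⟨φ, hφ⟩ := hint
  let _ : (orderedRingGraph n).Structure K := fieldExpansion K D n f
  -- The formula obtained uses no parameters.
  refine Set.Definable.mono (A := ∅) ?_ (Set.empty_subset _)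
  rw [Set.empty_definable_iff]
  exact ⟨φ, Set.ext fun v => (hφ v).symm⟩
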